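/- Let $\Bbbk$ be an algebraically closed field, $G$ a finite group, $n\ge 0$, and let $H=\Bbbk[G]$ be the algebra of all functions $G\to\Bbbk$, with left shifts $(L_gf)(x)=f(gx)$ and basis $T_g$ $(g\in G)$, $T_g(\gamma)=\delta_{g,\gamma}$. Let $M_n=H\otimes\Bbbk^n$ be the free $H$-module of rank $n$. Let $\mathrm{Cend}_n=\mathrm{Cend}_n^{G,G}$ be the space of all maps $a:G\to\mathrm{End}_{\Bbbk}M_n$ such that $a(g)(fu)=(L_gf)\,(a(g)u)$ for all $g\in G$, $f\in H$, $u\in M_n$. It is a conformal algebra over $G$ with the $H$-module structure $(fa)(g)=f(g^{-1})a(g)$ and the products $(a\circ_g b)(z)=a(g)b(zg^{-1})$, $g,z\in G$, and it is identified with $H\otimes H\otimes \mathbb M_n(\Bbbk)$ by letting $h\otimes f\otimes A$ be the map $z\mapsto h(z^{-1})\,f\,L_z\otimes A$. A conformal subalgebra is an $H$-submodule closed under all products $\circ_g$; an automorphism of $\mathrm{Cend}_n$ is an $H$-linear bijection preserving all products $\circ_g$. A conformal subalgebra $C\subseteq\mathrm{Cend}_n$ is irreducible if $C\neq 0$ and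 $M_n$ has no $H$-submodules invariant under all operators $a(g)$, $a\in C$, $g\in G$, except for $\{0\}$ and $M_n$. Let $C$ be an irreducible conformal subalgebra of $\mathrm{Cend}_n$. Then there exist an automorphism $\theta$ of the conformal algebra $\mathrm{Cend}_n$, a subgroup $G_1$ of $G$ with left cosets $\{gG_1\mid g\in G\}=\{G_1,\dots,G_p\}$, and a function $\chi:G\times G\to\Bbbk^*$ such that for all $g,h\in G$ and $k\in\{1,\dots,p\}$ the value $$\frac{\chi(g,\gamma)\,\chi(h,g^{-1}\gamma)}{\chi(gh,\gamma)}\in\Bbbk^*$$ does not depend on the choice of $\gamma\in G_k$, and $\theta(C)=C_{G_1,\chi}$, where $$C_{G_1,\chi}=\Big\{\sum_{g\in G}T_g\otimes\sum_{k=1}^p\sum_{\alpha\in G_k}T_\alpha\otimes\chi(g,\alpha)\,a_{g,k}\ \Big|\ a_{g,k}\in\mathbb M_n(\Bbbk)\Big\}.$$ -/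

import Mathlib

namespace FiniteConformal

variable (k G : Type*) [Field k]

/-- The coordinate algebra `H = k[G]` of a finite group `G`, viewed as a linear algebraic group
over `k`: the algebra of all functions `G → k` with pointwise operations. -/
abbrev H : Type _ := G → k

/-- The regular functions on `G` with values in a vector space `N`: those of the form
`g ↦ ∑ hᵢ(g) vᵢ`, a finite sum with `hᵢ ∈ H` and `vᵢ ∈ N` (the image of `H ⊗ N`). -/
def regularMaps (N : Type*) [AddCommGroup N] [Module k N] : Submodule k (G → N) :=
  Submodule.span k (Set.range fun p : H k G × N => fun g => p.1 g • p.2)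

theorem mem_regularMaps [Finite G] {N : Type*} [AddCommGroup N] [Module k N] (f : G → N) :
    f ∈ regularMaps k G N := by
  classical
  have := Fintype.ofFinite G
  have hf : f = ∑ x : G, fun g => (Pi.single x (1 : k) : H k G) g • f x := by
    funext g
    simp [Finset.sum_apply, Pi.single_apply]
  rw [hf]
  exact Submodule.sum_mem _ fun x _ => Submodule.subset_span ⟨(Pi.single x 1, f x), rfl⟩

variable {k G} [Group G]

/-- The left shift `(L_g f)(x) = f(g x)`. -/
def leftShift (g : G) (f : H k G) : H k G := fun x => f (g * x)

variable (k G)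

/-- A conformal algebra over the finite group `G`: an `H`-module with bilinear products
`(a ∘_g b)`, `g ∈ G`, that are regular in `g` and satisfy `(h a ∘_g b) = h(g⁻¹) (a ∘_g b)` and
`(a ∘_g h b) = (L_g h) (a ∘_g b)`. -/
class ConformalAlgebra (C : Type*) [AddCommGroup C] [Module k C] [Module (H k G) C]
    [IsScalarTower k (H k G) C] where
  /-- the product `a ∘_g b` -/
  prod : G → C →ₗ[k] C →ₗ[k] C
  prod_regular : ∀ a b : C, (fun g => prod g a b) ∈ regularMaps k G C
  smul_prod : ∀ (g : G) (h : H k G) (a b : C), prod g (h • a) b = h g⁻¹ • prod g a b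
  prod_smul : ∀ (g : G) (h : H k G) (a b : C),
    prod g a (h • b) = leftShift g h • prod g a b

/-- A conformal subalgebra: an `H`-submodule closed under all products. -/
structure ConformalSubalgebra (C : Type*) [AddCommGroup C] [Module k C] [Module (H k G) C]
    [IsScalarTower k (H k G) C] [ConformalAlgebra k G C] extends Submodule (H k G) C where
  prod_mem : ∀ (g : G) {a b : C}, a ∈ carrier → b ∈ carrier →
    ConformalAlgebra.prod (k := k) g a b ∈ carrier

/-- An automorphism of a conformal algebra: an `H`-linear bijection preserving all products. -/
structure ConformalAut (C : Type*) [AddCommGroup C] [Module k C] [Module (H k G) C]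
    [IsScalarTower k (H k G) C] [ConformalAlgebra k G C] extends C ≃ₗ[H k G] C where
  map_prod : ∀ (g : G) (a b : C), toLinearEquiv (ConformalAlgebra.prod (k := k) g a b) =
    ConformalAlgebra.prod (k := k) g (toLinearEquiv a) (toLinearEquiv b)

/-- The free `H`-module `M_n` of rank `n`; `u : M_n` is the vector-valued function on `G`
with coordinates `u i : G → k`. -/
abbrev FreeMod (n : ℕ) : Type _ := Fin n → H k G

/-- Conformal endomorphisms of `M_n`: locally regular maps `a : G → End_k M_n` that are
translation invariant, `a(g)(f u) = (L_g f)(a(g) u)`. -/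
def cendSubmodule (n : ℕ) : Submodule k (G → Module.End k (FreeMod k G n)) where
  carrier := {a | (∀ u, (fun g => a g u) ∈ regularMaps k G (FreeMod k G n)) ∧
    ∀ (g : G) (f : H k G) (u : FreeMod k G n), a g (f • u) = leftShift g f • a g u}
  add_mem' := by
    rintro a b ⟨ha, ha'⟩ ⟨hb, hb'⟩
    refine ⟨fun u => Submodule.add_mem _ (ha u) (hb u), fun g f u => ?_⟩
    simp [ha', hb', smul_add]
  zero_mem' := ⟨fun u => Submodule.zero_mem _, fun g f u => by simp⟩
  smul_mem' := by
    rintro c a ⟨ha, ha'⟩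
    refine ⟨fun u => Submodule.smul_mem _ c (ha u), fun g f u => ?_⟩
    simp [ha', smul_comm c]

/-- `Cend_n = Cend_n^{G,G}`, the space of conformal endomorphisms of `M_n`. -/
def Cend (n : ℕ) : Type _ := ↥(cendSubmodule k G n)

namespace Cend

variable {k G} {n : ℕ}

instance : AddCommGroup (Cend k G n) := inferInstanceAs (AddCommGroup ↥(cendSubmodule k G n))

instance : Module k (Cend k G n) := inferInstanceAs (Module k ↥(cendSubmodule k G n))

/-- The operator `a(g) ∈ End_k M_n`. -/
def op (a : Cend k G n) (g : G) : Module.End k (FreeMod k G n) := a.1 g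

theorem ext_op {a b : Cend k G n} (h : ∀ g u, a.op g u = b.op g u) : a = b :=
  Subtype.ext (funext fun g => LinearMap.ext (h g))

theorem op_add (a b : Cend k G n) (g : G) : (a + b).op g = a.op g + b.op g := rfl

theorem op_zero (g : G) : (0 : Cend k G n).op g = 0 := rfl

theorem op_smul (c : k) (a : Cend k G n) (g : G) : (c • a).op g = c • a.op g := rfl

theorem op_tinv (a : Cend k G n) (g : G) (f : H k G) (u : FreeMod k G n) :
    a.op g (f • u) = leftShift g f • a.op g u := a.2.2 g f u

variable [Finite G]

/-- Build a conformal endomorphism; local regularity is automatic over a finite group. -/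
def mk (a : G → Module.End k (FreeMod k G n))
    (ha : ∀ (g : G) (f : H k G) (u : FreeMod k G n), a g (f • u) = leftShift g f • a g u) :
    Cend k G n :=
  ⟨a, fun _ => mem_regularMaps k G _, ha⟩

/-- The `H`-module structure `(f a)(g) = f(g⁻¹) a(g)`. -/
instance : SMul (H k G) (Cend k G n) where
  smul f a := mk (fun g => f g⁻¹ • a.op g) fun g h u => by
    simp [op_tinv, smul_comm (f g⁻¹)]

theorem op_hsmul (f : H k G) (a : Cend k G n) (g : G) :
    (f • a).op g = f g⁻¹ • a.op g := rfl

instance : Module (H k G) (Cend k G n) where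
  one_smul a := ext_op fun g u => by simp [op_hsmul]
  mul_smul f h a := ext_op fun g u => by simp [op_hsmul, mul_smul]
  smul_zero f := ext_op fun g u => by simp [op_hsmul, op_zero]
  smul_add f a b := ext_op fun g u => by simp [op_hsmul, op_add]
  add_smul f h a := ext_op fun g u => by simp [op_hsmul, op_add, add_smul]
  zero_smul a := ext_op fun g u => by simp [op_hsmul, op_zero]

instance : IsScalarTower k (H k G) (Cend k G n) where
  smul_assoc c f a := ext_op fun g u => by simp [op_hsmul, op_smul, mul_smul]

/-- The product `(a ∘_g b)(z) = a(g) b(z g⁻¹)`. -/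
def prod (g : G) (a b : Cend k G n) : Cend k G n :=
  mk (fun z => a.op g * b.op (z * g⁻¹)) fun z f u => by
    have h : leftShift g (leftShift (z * g⁻¹) f) = leftShift z f := by
      funext x
      simp [leftShift, mul_assoc]
    simp [op_tinv, h]

theorem op_prod (g : G) (a b : Cend k G n) (z : G) :
    (prod g a b).op z = a.op g * b.op (z * g⁻¹) := rfl

instance : ConformalAlgebra k G (Cend k G n) where
  prod g := LinearMap.mk₂ k (prod g)
    (fun a b c => ext_op fun z u => by simp [op_prod, op_add])
    (fun r a b => ext_op fun z u => by simp [op_prod, op_smul])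
    (fun a b c => ext_op fun z u => by simp [op_prod, op_add])
    (fun r a b => ext_op fun z u => by simp [op_prod, op_smul])
  prod_regular _ _ := mem_regularMaps k G _
  smul_prod g h a b := ext_op fun z u => by simp [op_prod, op_smul, op_hsmul]
  prod_smul g h a b := ext_op fun z u => by
    simp [op_prod, op_hsmul, leftShift]

/-- The element of `Cend_n` identified with `h ⊗ f ⊗ A ∈ H ⊗ H ⊗ M_n(k)`: it is the map
`z ↦ h(z⁻¹) f L_z ⊗ A`. -/
def tmul (h f : H k G) (A : Matrix (Fin n) (Fin n) k) : Cend k G n :=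
  mk (fun z =>
    { toFun := fun u i x => h z⁻¹ * f x * ∑ j, A i j * u j (z * x)
      map_add' := fun u v => by
        funext i x
        simp [mul_add, Finset.sum_add_distrib]
      map_smul' := fun c u => by
        funext i x
        simp only [Pi.smul_apply, smul_eq_mul, RingHom.id_apply, Finset.mul_sum]
        exact Finset.sum_congr rfl fun j _ => by ring })
    fun z f' u => by
      funext i x
      simp only [LinearMap.coe_mk, AddHom.coe_mk, Pi.smul_apply, smul_eq_mul, Pi.mul_apply,
        leftShift, Finset.mul_sum]
      exact Finset.sum_congr rfl fun j _ => by ring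

end Cend

variable {k G} {n : ℕ} [Finite G]

/-- `W_n(C)`, the linear span of all operators `a(g)`, `a ∈ C`, `g ∈ G`. -/
def operatorSpan (C : ConformalSubalgebra k G (Cend k G n)) :
    Submodule k (Module.End k (FreeMod k G n)) :=
  Submodule.span k {w | ∃ a ∈ C.toSubmodule, ∃ g : G, w = a.op g}

/-- `C` is irreducible: `C` is nonzero, and `M_n` has no `W_n(C)`-invariant `H`-submodules
except for `{0}` and `M_n`. -/
def IsIrreducible (C : ConformalSubalgebra k G (Cend k G n)) : Prop :=
  C.toSubmodule ≠ ⊥ ∧ ∀ N : Submodule (H k G) (FreeMod k G n),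
    (∀ w ∈ operatorSpan C, ∀ u ∈ N, w u ∈ N) → N = ⊥ ∨ N = ⊤

/-- For all `g, h`, the value `χ(g,γ) χ(h,g⁻¹γ) / χ(gh,γ)` depends only on the left coset
`γ G₁`. -/
def CosetCocycle (G₁ : Subgroup G) (χ : G → G → kˣ) : Prop :=
  ∀ g h γ γ' : G, (γ : G ⧸ G₁) = (γ' : G ⧸ G₁) →
    χ g γ * χ h (g⁻¹ * γ) / χ (g * h) γ = χ g γ' * χ h (g⁻¹ * γ') / χ (g * h) γ'

/-- `C_{G₁,χ}`: all elements
`∑_{g ∈ G} T_g ⊗ ∑_{K ∈ G/G₁} ∑_{α ∈ K} T_α ⊗ χ(g,α) a_{g,K}` with matrices `a_{g,K}`, where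
`T_g = Pi.single g 1` is the indicator function of `g`. Summing over the cosets `K` and over
`α ∈ K` is summing over `α ∈ G` with `K` the coset of `α`. -/
def cosetAlgebra [Fintype G] [DecidableEq G] (G₁ : Subgroup G) (χ : G → G → kˣ) :
    Set (Cend k G n) :=
  {x | ∃ a : G → G ⧸ G₁ → Matrix (Fin n) (Fin n) k,
    x = ∑ g : G, ∑ α : G,
      Cend.tmul (Pi.single g 1) (Pi.single α 1) ((χ g α : k) • a g (α : G ⧸ G₁))}

end FiniteConformal

/-!
Writing `(a(g) u)(x) = A_g(x) u(g x)` turns `Cend_n` into families of matrix-valued functions `A_g`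
on `G`, the product of an element `A` of degree `g` and an element `B` of degree `h` being the
function `x ↦ A(x) B(g x)` of degree `h g`. A conformal subalgebra is the sum of its homogeneous
components, and an invariant `H`-submodule of `M_n` is a family of subspaces of `k^n` indexed by
`G`, so that Burnside's theorem shows that in every degree the coefficients of an irreducible `C`
take all values at every point.

The component of degree `1` is therefore an algebra of functions mapping onto `M_n(k)` at every
point. Two of its evaluations either have the same kernel, and then differ by an automorphism of
`M_n(k)`, which is inner, or can be separated. Having the same kernel is a left invariant
equivalence relation on `G`, so its classes are the left cosets of a subgroup `G₁`. The inner
automorphisms are removed by a gauge transformation `A(x) ↦ Q(x) A(x) Q(g x)⁻¹`, after which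
elements of degree `1` are constant on cosets. Multiplying an element of degree `g` by them on
either side, one sees that its values at points of one coset differ by central factors; these
are the scalars `χ(g, x)`.
-/

namespace FiniteConformal

section Idealizer

variable {k R : Type*} [CommRing k] [Ring R] [Algebra k R]

/-- The two-sided idealizer of a subspace `W`: if `W` is closed under multiplication, this is the
largest subalgebra in which `W` is a two-sided ideal. -/
def idealizer (W : Submodule k R) : Subalgebra k R where
  carrier := {r | ∀ a ∈ W, r * a ∈ W ∧ a * r ∈ W}
  mul_mem' {r s} hr hs a ha :=
    ⟨mul_assoc r s a ▸ (hr _ (hs a ha).1).1, mul_assoc a r s ▸ (hs _ (hr a ha).2).2⟩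
  add_mem' hr hs a ha := by
    simp only [add_mul, mul_add]
    exact ⟨W.add_mem (hr a ha).1 (hs a ha).1, W.add_mem (hr a ha).2 (hs a ha).2⟩
  algebraMap_mem' c a ha := by
    rw [← Algebra.commutes, ← Algebra.smul_def]
    exact ⟨W.smul_mem c ha, W.smul_mem c ha⟩

theorem mem_idealizer {W : Submodule k R} {r : R} :
    r ∈ idealizer W ↔ ∀ a ∈ W, r * a ∈ W ∧ a * r ∈ W := Iff.rfl

theorem le_idealizer {W : Submodule k R} (hW : ∀ a ∈ W, ∀ b ∈ W, a * b ∈ W) :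
    W ≤ Subalgebra.toSubmodule (idealizer W) :=
  fun r hr a ha => ⟨hW r hr a ha, hW a ha r hr⟩

theorem eq_top_of_idealizer_eq_top [IsSimpleRing R] {W : Submodule k R} (hW : W ≠ ⊥)
    (h : idealizer W = ⊤) : W = ⊤ := by
  have hideal (r : R) : ∀ a ∈ W, r * a ∈ W ∧ a * r ∈ W :=
    mem_idealizer.1 (h ▸ Algebra.mem_top)
  let I : TwoSidedIdeal R := .mk' W W.zero_mem W.add_mem W.neg_mem
    (fun {r a} ha => (hideal r a ha).1) (fun {a r} ha => (hideal r a ha).2)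
  have hI {a : R} : a ∈ I ↔ a ∈ W := TwoSidedIdeal.mem_mk' ..
  obtain ⟨a, ha, ha0⟩ := W.ne_bot_iff.1 hW
  have hone := hI.1 (IsSimpleRing.one_mem_of_ne_zero_mem I ha0 (hI.2 ha))
  exact eq_top_iff.2 fun r _ => mul_one r ▸ (hideal r 1 hone).1

end Idealizer

section Burnside

variable {k R V X : Type*} [Field k] [Ring R] [Algebra k R] [AddCommGroup V] [Module R V]
  [FaithfulSMul R V]

variable (R V) in
theorem nontrivial_of_faithfulSMul [Nontrivial R] : Nontrivial V := by
  by_contra! h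
  exact one_ne_zero (α := R) (FaithfulSMul.eq_of_smul_eq_smul fun v : V => Subsingleton.elim _ _)

variable [Module k V] [IsScalarTower k R V]

theorem subalgebra_eq_top_of_isSimpleModule [IsAlgClosed k] [FiniteDimensional k V]
    (S : Subalgebra k R) [IsSimpleModule S V] : S = ⊤ := by
  classical
  refine eq_top_iff.2 fun r _ => ?_
  have schur := IsSimpleModule.algebraMap_end_bijective_of_isAlgClosed (A := S) (V := V) k
  let f : Module.End (Module.End S V) V :=
    { toFun := (r • ·)
      map_add' := smul_add r
      map_smul' := fun φ v => by
        obtain ⟨c, rfl⟩ := schur.2 φ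
        exact smul_algebra_smul_comm c r v }
  let b := Module.finBasis k V
  obtain ⟨s, hs⟩ := jacobson_density (R := S) f (Finset.univ.image b)
  have hrs : Module.toModuleEnd k (S := R) V r = Module.toModuleEnd k (S := R) V s :=
    b.ext fun i => hs (b i) (Finset.mem_image_of_mem b (Finset.mem_univ i))
  have : r = s := FaithfulSMul.eq_of_smul_eq_smul fun v : V => congr($hrs v)
  exact this ▸ s.2

theorem submodule_eq_top_of_transitive [IsAlgClosed k] [FiniteDimensional k V] [IsSimpleRing R]
    {W : Submodule k R} (hmul : ∀ a ∈ W, ∀ b ∈ W, a * b ∈ W)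
    (htrans : ∀ v : V, v ≠ 0 → ∀ w, ∃ a ∈ W, a • v = w) : W = ⊤ := by
  have : Nontrivial V := nontrivial_of_faithfulSMul R V
  have : IsSimpleModule (idealizer W) V :=
    isSimpleModule_iff_toSpanSingleton_surjective.2 ⟨‹_›, fun v hv w =>
      have ⟨a, ha, haw⟩ := htrans v hv w
      ⟨⟨a, le_idealizer hmul ha⟩, haw⟩⟩
  refine eq_top_of_idealizer_eq_top ?_ (subalgebra_eq_top_of_isSimpleModule (V := V) _)
  rintro rfl
  obtain ⟨v, hv⟩ := exists_ne (0 : V)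
  obtain ⟨a, rfl, hav⟩ := htrans v hv v
  exact hv (hav.symm.trans (zero_smul R v))

/-- A family `W x y` of subspaces of `R` (the blocks of an algebra of `X × X` matrices over `R`)
is an irreducible block algebra on `V` if it is closed under block multiplication, is nonzero, and
has no invariant families of subspaces of `V` except for the two trivial ones. -/
structure IsIrreducibleBlockAlgebra (V : Type*) [AddCommGroup V] [Module R V] [Module k V]
    (W : X → X → Submodule k R) : Prop where
  mul_mem : ∀ {x y z a b}, a ∈ W x y → b ∈ W y z → a * b ∈ W x z
  exists_ne_bot : ∃ x y, W x y ≠ ⊥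
  invariant : ∀ N : X → Submodule k V, (∀ x y, ∀ a ∈ W x y, ∀ v ∈ N y, a • v ∈ N x) →
    (∀ x, N x = ⊥) ∨ ∀ x, N x = ⊤

namespace IsIrreducibleBlockAlgebra

variable {W : X → X → Submodule k R} (hW : IsIrreducibleBlockAlgebra V W)
include hW

theorem exists_smul_ne_zero (y : X) {v : V} (hv : v ≠ 0) : ∃ x, ∃ a ∈ W x y, a • v ≠ 0 := by
  let N (y : X) : Submodule k V :=
    { carrier := {v | ∀ x, ∀ a ∈ W x y, a • v = 0}
      add_mem' := fun hv hw x a ha => by rw [smul_add, hv x a ha, hw x a ha, add_zero]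
      zero_mem' := fun x a _ => smul_zero a
      smul_mem' := fun c v hv x a ha => by rw [smul_algebra_smul_comm, hv x a ha, smul_zero] }
  have hN (x y) (a) (ha : a ∈ W x y) (v) (hv : v ∈ N y) : a • v ∈ N x := fun z b hb => by
    rw [← mul_smul]
    exact hv z _ (hW.mul_mem hb ha)
  by_contra! h
  rcases hW.invariant N hN with hbot | htop
  · exact hv ((Submodule.mem_bot k).1 (hbot y ▸ (h : v ∈ N y)))
  · obtain ⟨x, y, hxy⟩ := hW.exists_ne_bot
    refine hxy ((Submodule.eq_bot_iff _).2 fun a ha => FaithfulSMul.eq_of_smul_eq_smul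
      fun w : V => ?_)
    have hw : w ∈ N y := htop y ▸ Submodule.mem_top
    rw [hw x a ha, zero_smul]

theorem exists_smul_eq (x y : X) {v : V} (hv : v ≠ 0) (w : V) : ∃ a ∈ W x y, a • v = w := by
  let N (x : X) : Submodule k V :=
    (W x y).map ((LinearMap.toSpanSingleton R V v).restrictScalars k)
  have hN (x z) (a) (ha : a ∈ W x z) (u) (hu : u ∈ N z) : a • u ∈ N x := by
    obtain ⟨b, hb, rfl⟩ := hu
    exact ⟨a * b, hW.mul_mem ha hb, mul_smul a b v⟩
  obtain ⟨z, a, ha, hav⟩ := hW.exists_smul_ne_zero y hv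
  rcases hW.invariant N hN with hbot | htop
  · exact absurd ((Submodule.mem_bot k).1 (hbot z ▸ ⟨a, ha, rfl⟩)) hav
  · exact (htop x ▸ Submodule.mem_top : w ∈ N x)

theorem eq_top [IsAlgClosed k] [FiniteDimensional k V] [IsSimpleRing R] (x y : X) :
    W x y = ⊤ := by
  have : Nontrivial V := nontrivial_of_faithfulSMul R V
  have hdiag (x : X) : W x x = ⊤ :=
    submodule_eq_top_of_transitive (fun _ ha _ hb => hW.mul_mem ha hb) fun _ hv =>
      hW.exists_smul_eq x x hv
  obtain ⟨v, hv⟩ := exists_ne (0 : V)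
  obtain ⟨a, ha, hav⟩ := hW.exists_smul_eq x y hv v
  refine eq_top_of_idealizer_eq_top ((W x y).ne_bot_iff.2 ⟨a, ha, ?_⟩) <| eq_top_iff.2
    fun r _ b hb => ⟨hW.mul_mem (hdiag x ▸ Submodule.mem_top) hb,
      hW.mul_mem hb (hdiag y ▸ Submodule.mem_top)⟩
  rintro rfl
  exact hv (hav.symm.trans (zero_smul R v))

end IsIrreducibleBlockAlgebra

end Burnside

section Linked

variable {k R X : Type*} [CommRing k] [Ring R] [Algebra k R]

/-- Two points are linked by an algebra `B` of `R`-valued functions if evaluations at these points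
have the same kernel on `B`. -/
def linked (B : Subalgebra k (X → R)) : Setoid X where
  r x y := ∀ A ∈ B, A x = 0 ↔ A y = 0
  iseqv :=
    { refl _ _ _ := Iff.rfl
      symm h A hA := (h A hA).symm
      trans h h' A hA := (h A hA).trans (h' A hA) }

variable {B : Subalgebra k (X → R)} {x y : X}

theorem linked_def : linked B x y ↔ ∀ A ∈ B, A x = 0 ↔ A y = 0 := Iff.rfl

theorem eq_one_of_linked (h : linked B x y) {A : X → R} (hA : A ∈ B) (hx : A x = 1) : A y = 1 :=
  sub_eq_zero.1 <| (h (A - 1) (B.sub_mem hA B.one_mem)).1 <| sub_eq_zero.2 hx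

variable (hB : ∀ x r, ∃ A ∈ B, A x = r)
include hB

theorem exists_algEquiv_of_linked (h : linked B x y) :
    ∃ φ : R ≃ₐ[k] R, ∀ A ∈ B, A y = φ (A x) := by
  let ev (z : X) : B →ₐ[k] R := (Pi.evalAlgHom k (fun _ => R) z).comp B.val
  have hev (z : X) : Function.Surjective (ev z) := fun r =>
    have ⟨A, hA, hAr⟩ := hB z r
    ⟨⟨A, hA⟩, hAr⟩
  have hker : RingHom.ker (ev x) = RingHom.ker (ev y) := Ideal.ext fun A => h A A.2
  let e (z : X) : (B ⧸ RingHom.ker (ev z)) ≃ₐ[k] R :=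
    Ideal.quotientKerAlgEquivOfSurjective (hev z)
  have he (A : B) : (e x).symm (A.1 x) = Ideal.Quotient.mk _ A :=
    (e x).symm_apply_eq.2 rfl
  refine ⟨((e x).symm.trans (Ideal.quotientEquivAlgOfEq k hker)).trans (e y), fun A hA => ?_⟩
  rw [AlgEquiv.trans_apply, AlgEquiv.trans_apply, he ⟨A, hA⟩]
  rfl

variable [IsSimpleRing R]

theorem exists_eq_one_eq_zero_of_ne_zero {A : X → R} (hA : A ∈ B) (hx : A x ≠ 0) (hy : A y = 0) :
    ∃ E ∈ B, E x = 1 ∧ E y = 0 := by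
  let M : Submodule k (X → R) :=
    Subalgebra.toSubmodule B ⊓ LinearMap.ker (LinearMap.proj (R := k) (φ := fun _ : X => R) y)
  let W : Submodule k R := M.map (LinearMap.proj x)
  have hW : W = ⊤ := by
    refine eq_top_of_idealizer_eq_top (W.ne_bot_iff.2 ⟨_, ⟨A, ⟨hA, hy⟩, rfl⟩, hx⟩) <|
      eq_top_iff.2 fun r _ => ?_
    obtain ⟨D, hD, rfl⟩ := hB x r
    rintro _ ⟨E, ⟨hE, hEy : E y = 0⟩, rfl⟩
    exact ⟨⟨D * E, ⟨B.mul_mem hD hE, by simp [hEy]⟩, rfl⟩,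
      ⟨E * D, ⟨B.mul_mem hE hD, by simp [hEy]⟩, rfl⟩⟩
  obtain ⟨E, ⟨hE, hEy⟩, hEx⟩ := (hW ▸ Submodule.mem_top : (1 : R) ∈ W)
  exact ⟨E, hE, hEx, hEy⟩

theorem exists_eq_one_eq_zero_of_not_linked (h : ¬ linked B x y) :
    ∃ E ∈ B, E x = 1 ∧ E y = 0 := by
  rw [linked_def] at h
  push Not at h
  obtain ⟨A, hA, ⟨hx, hy⟩ | ⟨hx, hy⟩⟩ := h
  · obtain ⟨E, hE, hEy, hEx⟩ := exists_eq_one_eq_zero_of_ne_zero hB hA hy hx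
    exact ⟨1 - E, B.sub_mem B.one_mem hE, by simp [hEx], by simp [hEy]⟩
  · exact exists_eq_one_eq_zero_of_ne_zero hB hA hx hy

theorem indicator_linked_mem [Finite X] (x : X) :
    {y | linked B x y}.indicator (1 : X → R) ∈ B := by
  have separate (s : Set X) (hs : ∀ y ∈ s, ¬ linked B x y) :
      ∃ E ∈ B, E x = 1 ∧ ∀ y ∈ s, E y = 0 := by
    induction s, s.toFinite using Set.Finite.induction_on with
    | empty => exact ⟨1, B.one_mem, rfl, by simp⟩
    | @insert y s _ _ ih =>
      obtain ⟨E, hE, hEx, hEs⟩ := ih fun z hz => hs z (.inr hz)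
      obtain ⟨D, hD, hDx, hDy⟩ :=
        exists_eq_one_eq_zero_of_not_linked hB (hs y (s.mem_insert y))
      refine ⟨D * E, B.mul_mem hD hE, by simp [hDx, hEx], ?_⟩
      rintro z (rfl | hz)
      · simp [hDy]
      · simp [hEs z hz]
  obtain ⟨E, hE, hEx, hE0⟩ := separate {y | ¬ linked B x y} fun _ hy => hy
  convert hE using 1
  funext y
  by_cases h : linked B x y
  · rw [Set.indicator_of_mem h, Pi.one_apply, eq_one_of_linked h hE hEx]
  · rw [Set.indicator_of_notMem h, hE0 y h]

end Linked

/-- The gauge transformation `A(x) ↦ Q(x) A(x) Q(g x)⁻¹` in degree `g`, a change of basis in each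
fibre over `X`. -/
@[simps]
def gaugeEquiv (k : Type*) {G X R : Type*} [CommRing k] [Group G] [MulAction G X] [Ring R]
    [Algebra k R] (Q : X → Rˣ) (g : G) :
    (X → R) ≃ₗ[k] (X → R) where
  toFun A x := Q x * A x * ↑(Q (g • x))⁻¹
  invFun A x := ↑(Q x)⁻¹ * A x * Q (g • x)
  map_add' A B := funext fun x => by simp [mul_add, add_mul]
  map_smul' c A := funext fun x => by simp
  left_inv A := funext fun x => by simp [mul_assoc]
  right_inv A := funext fun x => by simp [mul_assoc]

/-- A family of spaces of `R`-valued functions on a `G`-set `X`, indexed by `G`, which surjects onto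
`R` at every point and is closed under the twisted product `(A, B) ↦ (x ↦ A(x) B(g x))`. It is
the family of homogeneous components of a graded subalgebra of the skew group algebra of `G` over
`X → R`; the coefficients of an irreducible conformal subalgebra form such a family. -/
structure CoefficientSystem (k G X R : Type*) [CommRing k] [Group G] [MulAction G X] [Ring R]
    [Algebra k R] where
  comp : G → Submodule k (X → R)
  mul_mem : ∀ {g h : G} {A B : X → R}, A ∈ comp g → B ∈ comp h →
    (fun x => A x * B (g • x)) ∈ comp (h * g)
  exists_apply_eq : ∀ (g : G) (x : X) (r : R), ∃ A ∈ comp g, A x = r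

namespace CoefficientSystem

section Diagonal

variable {k G X R : Type*} [CommRing k] [Group G] [MulAction G X] [Ring R] [Algebra k R]
  (S : CoefficientSystem k G X R) {g : G} {A B : X → R} {x y : X}

theorem mul_mem_left (hA : A ∈ S.comp 1) (hB : B ∈ S.comp g) : A * B ∈ S.comp g := by
  have h := S.mul_mem hA hB
  simp only [one_smul, mul_one] at h
  exact h

theorem mul_mem_right (hA : A ∈ S.comp g) (hB : B ∈ S.comp 1) :
    (fun x => A x * B (g • x)) ∈ S.comp g := by
  simpa only [one_mul] using S.mul_mem hA hB

variable [Finite X]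

theorem one_mem : 1 ∈ S.comp 1 := by
  have approx (s : Set X) : ∃ E ∈ S.comp 1, ∀ x ∈ s, E x = 1 := by
    induction s, s.toFinite using Set.Finite.induction_on with
    | empty => exact ⟨0, zero_mem _, by simp⟩
    | @insert a s _ _ ih =>
      obtain ⟨E, hE, hEs⟩ := ih
      obtain ⟨D, hD, hDa⟩ := S.exists_apply_eq 1 a 1
      refine ⟨E + D - D * E, sub_mem (add_mem hE hD) (S.mul_mem_left hD hE), ?_⟩
      rintro x (rfl | hx)
      · simp [hDa]
      · simp [hEs x hx]
  obtain ⟨E, hE, hE1⟩ := approx Set.univ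
  exact (funext fun x => hE1 x trivial : E = 1) ▸ hE

/-- The component of degree `1`, as an algebra of functions with pointwise operations. -/
def diag : Subalgebra k (X → R) :=
  (S.comp 1).toSubalgebra S.one_mem fun _ _ => S.mul_mem_left

theorem mem_diag : A ∈ S.diag ↔ A ∈ S.comp 1 := Iff.rfl

theorem exists_mem_diag_apply_eq (x : X) (r : R) : ∃ A ∈ S.diag, A x = r :=
  S.exists_apply_eq 1 x r

/-- The elements of degree `1` are constant on the classes of linked points. -/
def IsNormalized : Prop :=
  ∀ A ∈ S.diag, ∀ x y, linked S.diag x y → A x = A y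

variable {S}

theorem eq_zero_of_linked (h : linked S.diag x y) (hA : A ∈ S.comp g) (hx : A x = 0) :
    A y = 0 := by
  -- A factor of degree `g⁻¹` takes `A` to degree `1`, where linked points are defined.
  obtain ⟨D, hD, hDy⟩ := S.exists_apply_eq g⁻¹ (g • y) 1
  have hAD : (fun z => A z * D (g • z)) ∈ S.diag := by
    simpa only [mem_diag, inv_mul_cancel] using S.mul_mem hA hD
  simpa [hDy] using (h _ hAD).1 (by simp [hx])

theorem eq_of_linked (h : linked S.diag x y) (hA : A ∈ S.comp g) (hB : B ∈ S.comp g)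
    (hx : A x = B x) : A y = B y :=
  sub_eq_zero.1 (eq_zero_of_linked h (sub_mem hA hB) (sub_eq_zero.2 hx : (A - B) x = 0) :)

theorem linked_smul (g : G) (h : linked S.diag x y) : linked S.diag (g • x) (g • y) := by
  have transport {x y : X} (h : linked S.diag x y) (A : X → R) (hA : A ∈ S.diag)
      (hx : A (g • x) = 0) : A (g • y) = 0 := by
    obtain ⟨D, hD, hDy⟩ := S.exists_apply_eq g y 1
    simpa [hDy] using eq_zero_of_linked h (S.mul_mem_right hD hA) (by simp [hx])
  exact fun A hA => ⟨transport h A hA, transport ((linked S.diag).symm h) A hA⟩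

theorem mem_of_forall_exists_eqOn [IsSimpleRing R]
    (hA : ∀ x, ∃ B ∈ S.comp g, ∀ y, linked S.diag x y → B y = A y) : A ∈ S.comp g := by
  classical
  have := Fintype.ofFinite (Quotient (linked S.diag))
  choose B hB hBA using hA
  have hsum : A = ∑ q : Quotient (linked S.diag),
      {y | linked S.diag q.out y}.indicator 1 * B q.out := by
    funext y
    have hy : linked S.diag (⟦y⟧ : Quotient (linked S.diag)).out y := Quotient.mk_out y
    rw [Finset.sum_apply, Finset.sum_eq_single ⟦y⟧]
    · rw [Pi.mul_apply, Set.indicator_of_mem hy, Pi.one_apply, one_mul, hBA _ _ hy]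
    · intro q _ hq
      rw [Pi.mul_apply, Set.indicator_of_notMem, zero_mul]
      exact fun h => hq <| q.out_eq.symm.trans <| Quotient.sound h
    · simp
  rw [hsum]
  exact sum_mem fun q _ =>
    S.mul_mem_left (indicator_linked_mem S.exists_mem_diag_apply_eq q.out) (hB q.out)

end Diagonal

section Twisted

variable {k G X R : Type*} [Field k] [Group G] [MulAction G X] [Ring R] [Algebra k R]
  (S : CoefficientSystem k G X R)

/-- The elements of degree `g` are the functions `x ↦ χ(g, x) a(x)` with `a` constant on the classes
of `r`. -/
def IsTwistedBy (r : Setoid X) (χ : G → X → kˣ) : Prop :=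
  ∀ g A, A ∈ S.comp g ↔ ∃ a : Quotient r → R, ∀ x, A x = (χ g x : k) • a ⟦x⟧

variable {S} in
theorem IsTwistedBy.cocycle [Nontrivial R] {r : Setoid X} {χ : G → X → kˣ}
    (hχ : S.IsTwistedBy r χ) (g h : G) {x y : X} (hxy : r x y) :
    χ g x * χ h (g • x) / χ (h * g) x = χ g y * χ h (g • y) / χ (h * g) y := by
  have hmem (g : G) : (fun x => (χ g x : k) • (1 : R)) ∈ S.comp g :=
    (hχ g _).2 ⟨1, fun _ => rfl⟩
  obtain ⟨a, ha⟩ := (hχ _ _).1 (S.mul_mem (hmem g) (hmem h))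
  have hval (x : X) : ((χ g x * χ h (g • x) / χ (h * g) x : kˣ) : k) • (1 : R) = a ⟦x⟧ := by
    have hx := ha x
    rw [smul_mul_smul_comm, one_mul] at hx
    rw [div_eq_inv_mul, Units.val_mul, mul_smul, Units.val_mul, hx, smul_smul, Units.inv_mul,
      one_smul]
  refine Units.ext (smul_left_injective k (one_ne_zero (α := R)) ?_)
  exact (hval x).trans ((congrArg a (Quotient.sound hxy)).trans (hval y).symm)

variable [Finite X]

namespace IsNormalized

variable {S} (hS : S.IsNormalized)
include hS

theorem exists_unit_smul [Nontrivial R] [Algebra.IsCentral k R] (g : G) {x y : X}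
    (h : linked S.diag x y) : ∃ c : kˣ, ∀ A ∈ S.comp g, A y = (c : k) • A x := by
  obtain ⟨D, hD, hDx⟩ := S.exists_apply_eq g x 1
  -- Degree `1` elements recover `A` from `D` on the left and on the right, so `D y` is central.
  have hleft {A : X → R} (hA : A ∈ S.comp g) : A y = A x * D y := by
    obtain ⟨L, hL, hLx⟩ := S.exists_mem_diag_apply_eq x (A x)
    rw [eq_of_linked h hA (S.mul_mem_left hL hD) (by simp [hLx, hDx]), Pi.mul_apply,
      ← hS L hL x y h, hLx]
  have hright {A : X → R} (hA : A ∈ S.comp g) : A y = D y * A x := by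
    obtain ⟨L, hL, hLx⟩ := S.exists_mem_diag_apply_eq (g • x) (A x)
    rw [eq_of_linked h hA (S.mul_mem_right hD hL) (by simp [hLx, hDx]),
      ← hS L hL _ _ (linked_smul g h), hLx]
  have hcentral : D y ∈ Subalgebra.center k R := Subalgebra.mem_center_iff.2 fun r => by
    obtain ⟨A, hA, rfl⟩ := S.exists_apply_eq g x r
    exact (hleft hA).symm.trans (hright hA)
  obtain ⟨c, hc⟩ := Algebra.mem_bot.1 (Algebra.IsCentral.out hcentral)
  have hsmul {A : X → R} (hA : A ∈ S.comp g) : A y = c • A x := by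
    rw [hright hA, ← hc, Algebra.smul_def]
  have hc0 : c ≠ 0 := by
    rintro rfl
    obtain ⟨A, hA, hAy⟩ := S.exists_apply_eq g y 1
    exact one_ne_zero (hAy.symm.trans ((hsmul hA).trans (zero_smul k _)))
  exact ⟨Units.mk0 c hc0, fun A => hsmul⟩

theorem exists_isTwistedBy [IsSimpleRing R] [Algebra.IsCentral k R] :
    ∃ χ, S.IsTwistedBy (linked S.diag) χ := by
  have hout (x : X) : linked S.diag (⟦x⟧ : Quotient (linked S.diag)).out x := Quotient.mk_out x
  choose χ hχ using fun g x => hS.exists_unit_smul g (hout x)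
  refine ⟨χ, fun g A => ⟨fun hA => ⟨fun q => A q.out, fun x => hχ g x A hA⟩, ?_⟩⟩
  rintro ⟨a, ha⟩
  refine mem_of_forall_exists_eqOn fun x => ?_
  obtain ⟨B, hB, hBx⟩ := S.exists_apply_eq g (⟦x⟧ : Quotient (linked S.diag)).out (a ⟦x⟧)
  refine ⟨B, hB, fun y hxy => ?_⟩
  rw [Quotient.sound hxy] at hBx
  rw [hχ g y B hB, hBx, ha]

end IsNormalized

end Twisted

section Gauge

variable {k G X R : Type*} [CommRing k] [Group G] [MulAction G X] [Ring R] [Algebra k R]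

variable (S : CoefficientSystem k G X R) (Q : X → Rˣ)

/-- The image of a coefficient system under a gauge transformation. -/
@[simps]
def gauge : CoefficientSystem k G X R where
  comp g := (S.comp g).map (gaugeEquiv k Q g : (X → R) →ₗ[k] (X → R))
  mul_mem := by
    rintro g h _ _ ⟨A, hA, rfl⟩ ⟨B, hB, rfl⟩
    exact ⟨_, S.mul_mem hA hB, funext fun x => by simp [mul_assoc, mul_smul]⟩
  exists_apply_eq g x r := by
    obtain ⟨A, hA, hAx⟩ := S.exists_apply_eq g x (↑(Q x)⁻¹ * r * Q (g • x))
    exact ⟨_, ⟨A, hA, rfl⟩, by simp [hAx, mul_assoc]⟩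

variable [Finite X]

theorem linked_gauge : linked (S.gauge Q).diag = linked S.diag := by
  have key (A : X → R) (x : X) : gaugeEquiv k Q (1 : G) A x = 0 ↔ A x = 0 := by simp
  ext x y
  simp only [linked_def, mem_diag, gauge_comp, Submodule.mem_map, forall_exists_index, and_imp,
    forall_apply_eq_imp_iff₂, LinearEquiv.coe_coe, key]

theorem exists_gauge_isNormalized
    (inner : ∀ φ : R ≃ₐ[k] R, ∃ u : Rˣ, ∀ r, φ r = u * r * ↑u⁻¹) :
    ∃ Q, (S.gauge Q).IsNormalized := by
  have hconj (x : X) : ∃ u : Rˣ, ∀ A ∈ S.diag,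
      A x = u * A (⟦x⟧ : Quotient (linked S.diag)).out * ↑u⁻¹ := by
    obtain ⟨φ, hφ⟩ := exists_algEquiv_of_linked S.exists_mem_diag_apply_eq (Quotient.mk_out x)
    obtain ⟨u, hu⟩ := inner φ
    exact ⟨u, fun A hA => (hφ A hA).trans (hu _)⟩
  choose P hP using hconj
  refine ⟨P⁻¹, ?_⟩
  rintro _ ⟨A, hA, rfl⟩ x y hxy
  have hval (x : X) : gaugeEquiv k P⁻¹ (1 : G) A x =
      A (⟦x⟧ : Quotient (linked S.diag)).out := by
    simp [hP x A hA, mul_assoc]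
  rw [linked_gauge] at hxy
  change gaugeEquiv k P⁻¹ (1 : G) A x = gaugeEquiv k P⁻¹ (1 : G) A y
  rw [hval, hval, Quotient.sound hxy]

end Gauge

theorem exists_gauge_isTwistedBy {k G X R : Type*} [Field k] [Group G] [MulAction G X] [Finite X]
    [Ring R] [Algebra k R] [IsSimpleRing R] [Algebra.IsCentral k R]
    (S : CoefficientSystem k G X R)
    (inner : ∀ φ : R ≃ₐ[k] R, ∃ u : Rˣ, ∀ r, φ r = u * r * ↑u⁻¹) :
    ∃ Q χ, (S.gauge Q).IsTwistedBy (linked S.diag) χ := by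
  obtain ⟨Q, hQ⟩ := S.exists_gauge_isNormalized inner
  exact ⟨Q, S.linked_gauge Q ▸ hQ.exists_isTwistedBy⟩

end CoefficientSystem

theorem exists_subgroup_leftRel_eq {G : Type*} [Group G] (r : Setoid G)
    (hr : ∀ g {x y}, r x y → r (g * x) (g * y)) :
    ∃ G₁ : Subgroup G, QuotientGroup.leftRel G₁ = r := by
  refine ⟨{ carrier := {g | r 1 g}, mul_mem' := ?_, one_mem' := r.refl 1, inv_mem' := ?_ }, ?_⟩
  · intro g h hg hh
    exact r.trans hg (by simpa using hr g hh)
  · intro g hg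
    exact r.symm (by simpa using hr g⁻¹ hg)
  · ext x y
    rw [QuotientGroup.leftRel_apply]
    exact ⟨fun h => by simpa using hr x h, fun h => by simpa using hr x⁻¹ h⟩

theorem CoefficientSystem.IsTwistedBy.cosetCocycle {k G R : Type*} [Field k] [Group G]
    [Ring R] [Nontrivial R] [Algebra k R] {S : CoefficientSystem k G G R} {G₁ : Subgroup G}
    {χ : G → G → kˣ}
    (hχ : S.IsTwistedBy (QuotientGroup.leftRel G₁) χ) : CosetCocycle G₁ fun g => χ g⁻¹ := by
  intro g h γ γ' hγ
  simpa only [mul_inv_rev, smul_eq_mul] using hχ.cocycle g⁻¹ h⁻¹ (Quotient.exact hγ)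

section Matrix

open Matrix

variable {k ι : Type*} [Field k] [Fintype ι] [DecidableEq ι]

theorem exists_unit_conj_eq (φ : Matrix ι ι k ≃ₐ[k] Matrix ι ι k) :
    ∃ P : (Matrix ι ι k)ˣ, ∀ A, φ A = P * A * (P⁻¹ : (Matrix ι ι k)ˣ) := by
  let e : Matrix ι ι k ≃ₐ[k] Module.End k (ι → k) := toLinAlgEquiv'
  obtain ⟨u, hu⟩ := Module.End.mulSemiringActionToAlgEquiv_conjAct_surjective
    ((e.symm.trans φ).trans e)
  refine ⟨Units.map e.symm.toMonoidHom (ConjAct.ofConjAct u), fun A => e.injective ?_⟩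
  have hA := congr($hu (e A))
  simpa [ConjAct.units_smul_def] using hA.symm

open scoped Matrix.Module

instance : FaithfulSMul (Matrix ι ι k) (ι → k) where
  eq_of_smul_eq_smul h := Matrix.ext_of_mulVec_single fun i => h (Pi.single i 1)

end Matrix

section Coordinates

open Matrix

variable {k G : Type*} [Field k] {n : ℕ}

theorem single_one_apply (i : Fin n) (x : G) :
    (fun j => (Pi.single i 1 : FreeMod k G n) j x) = Pi.single i 1 := by
  funext j
  by_cases hj : j = i <;> simp [hj]

/-- The vectors of `M_n` whose value at every `x` lies in `N x`. -/
def fibrewiseSubmodule (N : G → Submodule k (Fin n → k)) : Submodule (H k G) (FreeMod k G n) where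
  carrier := {u | ∀ x, (fun i => u i x) ∈ N x}
  add_mem' hu hv x := (N x).add_mem (hu x) (hv x)
  zero_mem' x := (N x).zero_mem
  smul_mem' f _ hu x := (N x).smul_mem (f x) (hu x)

theorem eq_bot_of_fibrewiseSubmodule_eq_bot {N : G → Submodule k (Fin n → k)}
    (h : fibrewiseSubmodule N = ⊥) (x : G) : N x = ⊥ := by
  classical
  refine (Submodule.eq_bot_iff _).2 fun v hv => ?_
  let u : FreeMod k G n := fun i => Pi.single x (v i)
  have hu : u ∈ fibrewiseSubmodule N := fun y => by
    by_cases hy : y = x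
    · subst hy
      simpa [u] using hv
    · have huy : (fun i => u i y) = 0 := funext fun i => by simp [u, hy]
      exact huy ▸ (N y).zero_mem
  have hu0 : u = 0 := by rwa [h, Submodule.mem_bot] at hu
  funext i
  simpa [u] using congrFun (congrFun hu0 i) x

theorem eq_top_of_fibrewiseSubmodule_eq_top {N : G → Submodule k (Fin n → k)}
    (h : fibrewiseSubmodule N = ⊤) (x : G) : N x = ⊤ :=
  eq_top_iff.2 fun v _ =>
    (h ▸ Submodule.mem_top : (fun i _ => v i : FreeMod k G n) ∈ fibrewiseSubmodule N) x

variable [Group G]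

namespace Cend

/-- The matrix-valued functions `x ↦ A_g(x)` with `(a(g) u)(x) = A_g(x) u(g x)`. -/
def coef (g : G) : Cend k G n →ₗ[k] G → Matrix (Fin n) (Fin n) k where
  toFun a x := Matrix.of fun i j => a.op g (Pi.single j 1) i x
  map_add' _ _ := rfl
  map_smul' _ _ := rfl

theorem op_apply (a : Cend k G n) (g : G) (u : FreeMod k G n) (x : G) :
    (fun i => a.op g u i x) = coef g a x *ᵥ fun j => u j (g * x) := by
  have hu : u = ∑ j, u j • (Pi.single j 1 : FreeMod k G n) := by
    funext i
    rw [Finset.sum_apply, Finset.sum_eq_single i] <;> simp +contextual [eq_comm]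
  funext i
  conv_lhs => rw [hu]
  simp only [map_sum, op_tinv, Finset.sum_apply, Pi.smul_apply, smul_eq_mul, Pi.mul_apply,
    leftShift, mulVec, dotProduct, coef]
  exact Finset.sum_congr rfl fun j _ => mul_comm _ _

theorem ext_coef {a b : Cend k G n} (h : ∀ g x, coef g a x = coef g b x) : a = b :=
  ext_op fun g u => by
    funext i x
    have e := (op_apply a g u x).trans (h g x ▸ (op_apply b g u x).symm)
    exact congrFun e i

variable [Finite G]

/-- The conformal endomorphism with prescribed coefficients. -/
def ofCoef (A : G → G → Matrix (Fin n) (Fin n) k) : Cend k G n :=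
  mk (fun g =>
    { toFun := fun u i x => (A g x *ᵥ fun j => u j (g * x)) i
      map_add' := fun u v => by
        funext i x
        exact congrFun (mulVec_add (A g x) (fun j => u j (g * x)) fun j => v j (g * x)) i
      map_smul' := fun c u => by
        funext i x
        exact congrFun (mulVec_smul (A g x) c fun j => u j (g * x)) i })
    fun g f u => by
      funext i x
      exact congrFun (mulVec_smul (A g x) (f (g * x)) fun j => u j (g * x)) i

theorem coef_ofCoef (A : G → G → Matrix (Fin n) (Fin n) k) (g : G) :
    coef g (ofCoef A) = A g := by
  ext x i j
  change (A g x *ᵥ fun l => (Pi.single j 1 : FreeMod k G n) l (g * x)) i = _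
  rw [single_one_apply, mulVec_single_one]
  rfl

theorem coef_hsmul (f : H k G) (a : Cend k G n) (g : G) :
    coef g (f • a) = f g⁻¹ • coef g a := rfl

theorem coef_prod (g : G) (a b : Cend k G n) (z x : G) :
    coef z (ConformalAlgebra.prod (k := k) g a b) x = coef g a x * coef (z * g⁻¹) b (g * x) :=
  Matrix.ext fun i j => congrFun (op_apply a g (b.op (z * g⁻¹) (Pi.single j 1)) x) i

theorem coef_tmul (h f : H k G) (A : Matrix (Fin n) (Fin n) k) (g x : G) :
    coef g (tmul h f A) x = (h g⁻¹ * f x) • A := by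
  ext i j
  change h g⁻¹ * f x * (A *ᵥ fun l => (Pi.single j 1 : FreeMod k G n) l (g * x)) i = _
  rw [single_one_apply, mulVec_single_one]
  rfl

/-- The automorphism of `Cend_n` given by the gauge transformation `A_g(x) ↦ Q(x) A_g(x) Q(g x)⁻¹`
of the coefficients. -/
def gaugeAut (Q : G → (Matrix (Fin n) (Fin n) k)ˣ) : ConformalAut k G (Cend k G n) where
  toFun a := ofCoef fun g => gaugeEquiv k Q g (coef g a)
  invFun a := ofCoef fun g => (gaugeEquiv k Q g).symm (coef g a)
  map_add' a b := ext_coef fun g x => by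
    simp only [map_add, coef_ofCoef]
  map_smul' f a := ext_coef fun g x => by
    simp only [coef_hsmul, coef_ofCoef, map_smul, RingHom.id_apply]
  left_inv a := ext_coef fun g x => by
    simp only [coef_ofCoef, LinearEquiv.symm_apply_apply]
  right_inv a := ext_coef fun g x => by
    simp only [coef_ofCoef, LinearEquiv.apply_symm_apply]
  map_prod g a b := ext_coef fun z x => by
    change coef z (ofCoef _) x =
      coef z (ConformalAlgebra.prod (k := k) g (ofCoef _) (ofCoef _)) x
    simp only [coef_ofCoef, coef_prod, gaugeEquiv_apply, smul_eq_mul, mul_assoc,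
      Units.inv_mul_cancel_left, inv_mul_cancel_left]

theorem coef_gaugeAut (Q : G → (Matrix (Fin n) (Fin n) k)ˣ) (a : Cend k G n) (g : G) :
    coef g ((gaugeAut Q).toLinearEquiv a) = gaugeEquiv k Q g (coef g a) :=
  coef_ofCoef _ g

end Cend

theorem mem_cosetAlgebra [Fintype G] [DecidableEq G] {G₁ : Subgroup G} {χ : G → G → kˣ}
    {x : Cend k G n} : x ∈ cosetAlgebra G₁ χ ↔
      ∀ g, ∃ a : G ⧸ G₁ → Matrix (Fin n) (Fin n) k, ∀ α : G,
        Cend.coef g⁻¹ x α = (χ g α : k) • a α := by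
  have key : ∀ (a : G → G ⧸ G₁ → Matrix (Fin n) (Fin n) k) (g α : G),
      Cend.coef g⁻¹ (∑ g : G, ∑ α : G,
        Cend.tmul (Pi.single g 1) (Pi.single α 1) ((χ g α : k) • a g (α : G ⧸ G₁))) α =
      (χ g α : k) • a g α := fun a g α => by
    simp only [map_sum, Finset.sum_apply, Cend.coef_tmul, inv_inv]
    rw [Finset.sum_eq_single g, Finset.sum_eq_single α] <;>
      simp +contextual [Pi.single_apply, eq_comm]
  constructor
  · rintro ⟨a, rfl⟩ g
    exact ⟨a g, key a g⟩
  · intro h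
    choose a ha using h
    refine ⟨a, Cend.ext_coef fun g α => ?_⟩
    rw [← inv_inv g, ha, key]

variable [Finite G]

/-- The coefficients of the operators `a(g)`, `a ∈ C`. -/
def coefSpace (C : ConformalSubalgebra k G (Cend k G n)) (g : G) :
    Submodule k (G → Matrix (Fin n) (Fin n) k) :=
  (C.toSubmodule.restrictScalars k).map (Cend.coef g)

theorem coef_mem_coefSpace {C : ConformalSubalgebra k G (Cend k G n)} {a : Cend k G n}
    (ha : a ∈ C.toSubmodule) (g : G) : Cend.coef g a ∈ coefSpace C g :=
  ⟨a, ha, rfl⟩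

theorem mem_of_forall_coef_mem (C : ConformalSubalgebra k G (Cend k G n)) {a : Cend k G n}
    (h : ∀ g, Cend.coef g a ∈ coefSpace C g) : a ∈ C.toSubmodule := by
  classical
  have := Fintype.ofFinite G
  choose b hb hba using h
  have e : a = ∑ g : G, (Pi.single g⁻¹ 1 : H k G) • b g := Cend.ext_coef fun z x => by
    rw [map_sum, Finset.sum_apply, Finset.sum_eq_single z]
    · rw [Cend.coef_hsmul, Pi.single_eq_same, one_smul, hba]
    · intro g _ hg
      rw [Cend.coef_hsmul, Pi.single_eq_of_ne (by simpa using hg.symm), zero_smul, Pi.zero_apply]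
    · simp
  rw [e]
  exact C.toSubmodule.sum_mem fun g _ => C.toSubmodule.smul_mem _ (hb g)

theorem mem_image_gaugeAut {C : ConformalSubalgebra k G (Cend k G n)}
    {Q : G → (Matrix (Fin n) (Fin n) k)ˣ} {b : Cend k G n} :
    b ∈ (Cend.gaugeAut Q).toLinearEquiv '' C.toSubmodule ↔
      ∀ g, Cend.coef g b ∈ (coefSpace C g).map (gaugeEquiv k Q g).toLinearMap := by
  constructor
  · rintro ⟨a, ha, rfl⟩ g
    exact ⟨_, coef_mem_coefSpace ha g, (Cend.coef_gaugeAut Q a g).symm⟩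
  · intro hb
    obtain ⟨a, rfl⟩ := (Cend.gaugeAut Q).toLinearEquiv.surjective b
    refine ⟨a, mem_of_forall_coef_mem C fun g => ?_, rfl⟩
    have hg := hb g
    rw [Cend.coef_gaugeAut] at hg
    simpa using (Submodule.mem_map_equiv _).1 hg

theorem mul_mem_coefSpace {C : ConformalSubalgebra k G (Cend k G n)} {g h : G}
    {A B : G → Matrix (Fin n) (Fin n) k} (hA : A ∈ coefSpace C g) (hB : B ∈ coefSpace C h) :
    (fun x => A x * B (g * x)) ∈ coefSpace C (h * g) := by
  obtain ⟨a, ha, rfl⟩ := hA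
  obtain ⟨b, hb, rfl⟩ := hB
  refine ⟨_, C.prod_mem g ha hb, funext fun x => ?_⟩
  rw [Cend.coef_prod, mul_inv_cancel_right]

theorem apply_mem_fibrewiseSubmodule {C : ConformalSubalgebra k G (Cend k G n)}
    {N : G → Submodule k (Fin n → k)}
    (hN : ∀ g, ∀ A ∈ coefSpace C g, ∀ x, ∀ v ∈ N (g * x), A x *ᵥ v ∈ N x)
    {w : Module.End k (FreeMod k G n)} (hw : w ∈ operatorSpan C) {u : FreeMod k G n}
    (hu : u ∈ fibrewiseSubmodule N) : w u ∈ fibrewiseSubmodule N := by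
  induction hw using Submodule.span_induction with
  | mem w hw =>
    obtain ⟨a, ha, g, rfl⟩ := hw
    intro x
    rw [Cend.op_apply]
    exact hN g _ (coef_mem_coefSpace ha g) x _ (hu (g * x))
  | zero => exact zero_mem _
  | add _ _ _ _ hw hw' => exact add_mem hw hw'
  | smul c _ _ hw => exact fun x => (N x).smul_mem c (hw x)

theorem IsIrreducible.forall_eq_bot_or_forall_eq_top {C : ConformalSubalgebra k G (Cend k G n)}
    (hC : IsIrreducible C) {N : G → Submodule k (Fin n → k)}
    (hN : ∀ g, ∀ A ∈ coefSpace C g, ∀ x, ∀ v ∈ N (g * x), A x *ᵥ v ∈ N x) :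
    (∀ x, N x = ⊥) ∨ ∀ x, N x = ⊤ :=
  (hC.2 (fibrewiseSubmodule N) fun _ hw _ hu => apply_mem_fibrewiseSubmodule hN hw hu).imp
    eq_bot_of_fibrewiseSubmodule_eq_bot eq_top_of_fibrewiseSubmodule_eq_top

/-- The values at `x` of the coefficients of `C` that map the fibre of `M_n` over `y` to the fibre
over `x`. -/
def coefBlock (C : ConformalSubalgebra k G (Cend k G n)) (x y : G) :
    Submodule k (Matrix (Fin n) (Fin n) k) :=
  (coefSpace C (y * x⁻¹)).map (LinearMap.proj x)

theorem apply_mem_coefBlock {C : ConformalSubalgebra k G (Cend k G n)} {g : G}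
    {A : G → Matrix (Fin n) (Fin n) k} (hA : A ∈ coefSpace C g) (x : G) :
    A x ∈ coefBlock C x (g * x) :=
  ⟨A, by rwa [mul_inv_cancel_right], rfl⟩

namespace IsIrreducible

variable {C : ConformalSubalgebra k G (Cend k G n)} (hC : IsIrreducible C)
include hC

theorem neZero : NeZero n where
  out := by
    rintro rfl
    exact hC.1 ((Submodule.eq_bot_iff _).2 fun a _ => Cend.ext_coef fun _ _ =>
      Subsingleton.elim _ _)

theorem exists_coefBlock_ne_bot : ∃ x y, coefBlock C x y ≠ ⊥ := by
  by_contra! h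
  refine hC.1 ((Submodule.eq_bot_iff _).2 fun a ha => Cend.ext_coef fun g x => ?_)
  have hx := apply_mem_coefBlock (coef_mem_coefSpace ha g) x
  rw [h, Submodule.mem_bot] at hx
  rw [hx, map_zero, Pi.zero_apply]

open scoped Matrix.Module in
theorem isIrreducibleBlockAlgebra :
    IsIrreducibleBlockAlgebra (Fin n → k) (coefBlock C) where
  mul_mem := by
    rintro x y z _ _ ⟨A, hA, rfl⟩ ⟨B, hB, rfl⟩
    have hAB := apply_mem_coefBlock (mul_mem_coefSpace hA hB) x
    simpa [mul_assoc] using hAB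
  exists_ne_bot := hC.exists_coefBlock_ne_bot
  invariant N hN := hC.forall_eq_bot_or_forall_eq_top fun g A hA x v hv =>
    hN x (g * x) (A x) (apply_mem_coefBlock hA x) v hv

open scoped Matrix.Module in
theorem coefBlock_eq_top [IsAlgClosed k] (x y : G) : coefBlock C x y = ⊤ := by
  have := hC.neZero
  exact hC.isIrreducibleBlockAlgebra.eq_top x y

/-- The coefficients of an irreducible conformal subalgebra, as a coefficient system. -/
def coefSystem [IsAlgClosed k] : CoefficientSystem k G G (Matrix (Fin n) (Fin n) k) where
  comp := coefSpace C
  mul_mem := mul_mem_coefSpace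
  exists_apply_eq g x r := by
    have hr : r ∈ coefBlock C x (g * x) := hC.coefBlock_eq_top x (g * x) ▸ Submodule.mem_top
    rwa [coefBlock, mul_inv_cancel_right] at hr

end IsIrreducible

end Coordinates

end FiniteConformal

open FiniteConformal in
theorem mainTheorem2 {k G : Type*} [Field k] [IsAlgClosed k] [Group G] [Fintype G]
    [DecidableEq G] (n : ℕ) (C : ConformalSubalgebra k G (Cend k G n)) (hC : IsIrreducible C) :
    ∃ (θ : ConformalAut k G (Cend k G n)) (G₁ : Subgroup G) (χ : G → G → kˣ),
      CosetCocycle G₁ χ ∧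
      θ.toLinearEquiv '' (C.toSubmodule : Set (Cend k G n)) = cosetAlgebra G₁ χ := by
  have := hC.neZero
  obtain ⟨Q, χ, hχ⟩ := hC.coefSystem.exists_gauge_isTwistedBy exists_unit_conj_eq
  obtain ⟨G₁, hG₁⟩ := exists_subgroup_leftRel_eq (linked hC.coefSystem.diag) fun g _ _ =>
    CoefficientSystem.linked_smul g
  rw [← hG₁] at hχ
  refine ⟨Cend.gaugeAut Q, G₁, fun g => χ g⁻¹, hχ.cosetCocycle, Set.ext fun b => ?_⟩
  rw [mem_image_gaugeAut, mem_cosetAlgebra, (Equiv.inv G).forall_congr_left]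
  exact forall_congr' fun g => hχ g⁻¹ _
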